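/- A numerical semigroup is a set $S\subseteq\mathbb{Z}_{\ge 0}$ that contains $0$, is closed under addition and has finite complement in $\mathbb{Z}_{\ge 0}$; its embedding dimension is the cardinality of its (unique) minimal generating set. Let $P_S(x)=(1-x)\sum_{s\in S}x^s$, which is a polynomial. Call $S$ symmetric if $P_S(x)=x^kP_S(x^{-1})$ for some integer $k\ge 0$, and cyclotomic if every complex root of $P_S$ lies on the unit circle. Let $SY_e$ and $CY_e$ denote the sets of symmetric and of cyclotomic numerical semigroups, respectively, of embedding dimension $e$. Theorem 2. For every integer $e\ge 4$ there exist two distinct numerical semigroups of embedding dimension $e$ each of which is symmetric but not cyclotomic. In particular, $CY_e\neq SY_e$. -/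

import Mathlib

/-- A numerical semigroup: a subset of `ℕ` that contains `0`, is closed under addition and contains
all but finitely many natural numbers. -/
structure NumericalSemigroup extends AddSubmonoid ℕ where
  finite_compl : (carrierᶜ).Finite

namespace NumericalSemigroup

/-- The Hilbert series `H_S(x) = ∑_{s ∈ S} x ^ s`, a formal power series. -/
noncomputable def hilbertSeries (S : NumericalSemigroup) : PowerSeries ℤ :=
  PowerSeries.mk (S.carrier.indicator 1)

/-- The finite set `ℕ \ S` of gaps of `S`. -/
noncomputable def gaps (S : NumericalSemigroup) : Finset ℕ :=
  S.finite_compl.toFinset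

/-- The numerical semigroup polynomial `P_S(x) = (1 - x) H_S(x)`, written as a polynomial by means of
`H_S(x) = 1 / (1 - x) - ∑_{g ∉ S} x ^ g`. The defining identity is proved in
`coe_semigroupPolynomial`. -/
noncomputable def semigroupPolynomial (S : NumericalSemigroup) : Polynomial ℤ :=
  1 - (1 - Polynomial.X) * ∑ g ∈ S.gaps, Polynomial.X ^ g

/-- The defining identity `P_S(x) = (1 - x) H_S(x)`, in the ring of formal power series. -/
theorem coe_semigroupPolynomial (S : NumericalSemigroup) :
    (S.semigroupPolynomial : PowerSeries ℤ) = (1 - PowerSeries.X) * S.hilbertSeries := by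
  have h1 : S.hilbertSeries + ((∑ g ∈ S.gaps, Polynomial.X ^ g : Polynomial ℤ) : PowerSeries ℤ)
      = PowerSeries.mk 1 := by
    ext n
    by_cases hn : n ∈ S.carrier <;>
      simp [hilbertSeries, gaps, Polynomial.coeff_X_pow, hn]
  have h2 : (1 - PowerSeries.X) * (PowerSeries.mk 1 : PowerSeries ℤ) = 1 := by
    rw [mul_comm]
    exact PowerSeries.mk_one_mul_one_sub_eq_one ℤ
  have h3 : (S.semigroupPolynomial : PowerSeries ℤ) = 1 - (1 - PowerSeries.X) *
      ((∑ g ∈ S.gaps, Polynomial.X ^ g : Polynomial ℤ) : PowerSeries ℤ) := by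
    simp only [semigroupPolynomial, Polynomial.coe_sub, Polynomial.coe_mul, Polynomial.coe_one,
      Polynomial.coe_X]
  rw [h3]
  linear_combination -h2 - (1 - PowerSeries.X) * h1

/-- `A` is the minimal generating set of `S`: it generates `S`, and no proper subset of it does. -/
def IsMinimalGeneratingSet (S : NumericalSemigroup) (A : Finset ℕ) : Prop :=
  Minimal (fun B : Finset ℕ => AddSubmonoid.closure (B : Set ℕ) = S.toAddSubmonoid) A

/-- `S` has embedding dimension `e`: its minimal generating set has exactly `e` elements. -/
def HasEmbeddingDimension (S : NumericalSemigroup) (e : ℕ) : Prop :=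
  ∃ A : Finset ℕ, S.IsMinimalGeneratingSet A ∧ A.card = e

/-- `S` is symmetric: `P_S(x) = x ^ k * P_S(x⁻¹)` for some natural number `k`, as an identity of
Laurent polynomials. -/
def IsSymmetric (S : NumericalSemigroup) : Prop :=
  ∃ k : ℕ, S.semigroupPolynomial.toLaurent =
    LaurentPolynomial.T (k : ℤ) * LaurentPolynomial.invert S.semigroupPolynomial.toLaurent

/-- `S` is cyclotomic: every complex root of `P_S` lies on the unit circle. -/
def IsCyclotomic (S : NumericalSemigroup) : Prop :=
  ∀ z : ℂ, Polynomial.aeval z S.semigroupPolynomial = 0 → ‖z‖ = 1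

/-- `SY_e`: the set of symmetric numerical semigroups of embedding dimension `e`. -/
def SY (e : ℕ) : Set NumericalSemigroup :=
  {S | S.HasEmbeddingDimension e ∧ S.IsSymmetric}

/-- `CY_e`: the set of cyclotomic numerical semigroups of embedding dimension `e`. -/
def CY (e : ℕ) : Set NumericalSemigroup :=
  {S | S.HasEmbeddingDimension e ∧ S.IsCyclotomic}

end NumericalSemigroup

/-!
If every root of `P` lies on the unit circle, then `θ ↦ log |P(e^{iθ})|` is concave on every
interval without zeros, being, up to a constant, a sum of functions `log |2 sin ((θ - α) / 2)|`.
In particular `|P|` has no positive strict local minimum on the circle. With `m = e + 1`, the two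
semigroups `{0} ∪ {n ≥ m | n ≠ 2m - 1}` and `{0} ∪ {n ≥ m | n ≠ m + 1, 2m + 1}` are symmetric of
embedding dimension `e`, and at `e^{2iφ}` their polynomials are, up to a factor of modulus one,
`1 - 4 sin φ sin ((2m - 1)φ)` and `1 - 8 sin φ sin ((m + 1)φ) cos (mφ)`. On `0 ≤ φ ≤ a`, with
`a = π / (2m - 1)` and `a = π / (2m)` respectively, each of these is `1` at both ends, less than `1`
at the midpoint, and positive throughout as soon as `m ≥ 5`, which contradicts concavity.
-/

section UnitCircle

open Complex Polynomial

theorem norm_eval_mul_norm_eval_le_sq {K : Type*} [NormedField K] {P : K[X]} (hP : P.Splits)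
    {x y w : K} (h : ∀ z ∈ P.roots, ‖x - z‖ * ‖y - z‖ ≤ ‖w - z‖ ^ 2) :
    ‖P.eval x‖ * ‖P.eval y‖ ≤ ‖P.eval w‖ ^ 2 := by
  have norm_eval (v : K) :
      ‖P.eval v‖ = ‖P.leadingCoeff‖ * (P.roots.map fun z => ‖v - z‖).prod := by
    have norm_prod := map_multiset_prod (normHom : K →*₀ ℝ) (P.roots.map fun z => v - z)
    rw [Multiset.map_map] at norm_prod
    rw [hP.eval_eq_prod_roots, norm_mul]
    exact congrArg _ norm_prod
  have hprod : (P.roots.map fun z => ‖x - z‖ * ‖y - z‖).prod ≤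
      (P.roots.map fun z => ‖w - z‖ ^ 2).prod :=
    Multiset.prod_map_le_prod_map₀ _ _ (fun _ _ => by positivity) h
  rw [Multiset.prod_map_mul, Multiset.prod_map_pow] at hprod
  calc ‖P.eval x‖ * ‖P.eval y‖
      = ‖P.leadingCoeff‖ ^ 2 *
          ((P.roots.map fun z => ‖x - z‖).prod * (P.roots.map fun z => ‖y - z‖).prod) := by
        rw [norm_eval, norm_eval]; ring
    _ ≤ ‖P.leadingCoeff‖ ^ 2 * (P.roots.map fun z => ‖w - z‖).prod ^ 2 := by gcongr
    _ = ‖P.eval w‖ ^ 2 := by rw [norm_eval, mul_pow]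

theorem norm_exp_neg_sub_mul_norm_exp_sub_le {z : ℂ} {δ : ℝ} (hz : ‖z‖ = 1)
    (hδ : z.re ≤ Real.cos δ) :
    ‖exp (-δ * I) - z‖ * ‖exp (δ * I) - z‖ ≤ ‖1 - z‖ ^ 2 := by
  have hzz : z * (starRingEnd ℂ) z = 1 := by simp [mul_conj', hz]
  have hre : z + (starRingEnd ℂ) z = 2 * z.re := by rw [add_conj]; push_cast; ring
  have hexp : exp (-δ * I) * exp (δ * I) = 1 := by rw [← exp_add]; simp
  have hcos : exp (-δ * I) + exp (δ * I) = 2 * Real.cos δ := by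
    rw [ofReal_cos, Complex.cos]; ring
  have hfactor : (exp (-δ * I) - z) * (exp (δ * I) - z) =
      z * ((2 * (z.re - Real.cos δ) : ℝ) : ℂ) := by
    push_cast [-ofReal_cos]
    linear_combination hexp - z * hcos - hzz + z * hre
  calc ‖exp (-δ * I) - z‖ * ‖exp (δ * I) - z‖
      = 2 * (Real.cos δ - z.re) := by
        rw [← norm_mul, hfactor, norm_mul, hz, one_mul, norm_real,
          Real.norm_of_nonpos (by linarith)]
        ring
    _ ≤ 2 * (1 - z.re) := by linarith [Real.cos_le_one δ]
    _ = ‖1 - z‖ ^ 2 := by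
        have hz2 : z.re * z.re + z.im * z.im = 1 := by
          rw [← normSq_apply, normSq_eq_norm_sq, hz, one_pow]
        rw [← normSq_eq_norm_sq, normSq_apply, sub_re, sub_im, one_re, one_im]
        linear_combination -hz2

theorem re_le_cos_of_forall_ne_exp {z : ℂ} {δ : ℝ} (hz : ‖z‖ = 1) (hδ : 0 ≤ δ)
    (h : ∀ θ ∈ Set.Ioo (-δ) δ, z ≠ exp (θ * I)) : z.re ≤ Real.cos δ := by
  have hexp : z = exp (arg z * I) := by simpa [hz] using (norm_mul_exp_arg_mul_I z).symm
  have harg : δ ≤ |arg z| := by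
    by_contra! hlt
    exact h _ (abs_lt.1 hlt) hexp
  calc z.re = Real.cos |arg z| := by
        rw [Real.cos_abs, cos_arg (norm_ne_zero_iff.1 (by simp [hz])), hz, div_one]
    _ ≤ Real.cos δ := Real.cos_le_cos_of_nonneg_of_le_pi hδ (abs_arg_le_pi z) harg

theorem norm_eval_exp_mul_norm_eval_exp_le_sq {P : ℂ[X]} (hP : ∀ z, P.IsRoot z → ‖z‖ = 1)
    {c δ : ℝ} (hδ : 0 ≤ δ) (harc : ∀ θ ∈ Set.Ioo (c - δ) (c + δ), P.eval (exp (θ * I)) ≠ 0) :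
    ‖P.eval (exp ((c - δ) * I))‖ * ‖P.eval (exp ((c + δ) * I))‖ ≤ ‖P.eval (exp (c * I))‖ ^ 2 := by
  refine norm_eval_mul_norm_eval_le_sq (IsAlgClosed.splits P) fun z hz => ?_
  have hroot : P.IsRoot z := isRoot_of_mem_roots hz
  obtain ⟨w, rfl⟩ : ∃ w, z = exp (c * I) * w :=
    ⟨_, (mul_div_cancel₀ z (exp_ne_zero _)).symm⟩
  have hw : ‖w‖ = 1 := by simpa [norm_exp_ofReal_mul_I] using hP _ hroot
  have hre : w.re ≤ Real.cos δ := by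
    refine re_le_cos_of_forall_ne_exp hw hδ fun θ hθ hwθ => ?_
    refine harc (c + θ) ⟨by linarith [hθ.1], by linarith [hθ.2]⟩ ?_
    rwa [ofReal_add, add_mul, exp_add, ← hwθ]
  have norm_rotate (s : ℂ) : ‖exp ((c + s) * I) - exp (c * I) * w‖ = ‖exp (s * I) - w‖ := by
    rw [add_mul, exp_add, ← mul_sub, norm_mul, norm_exp_ofReal_mul_I, one_mul]
  have norm_center : ‖exp (c * I) - exp (c * I) * w‖ = ‖1 - w‖ := by
    simpa using norm_rotate 0
  rw [sub_eq_add_neg (c : ℂ), norm_rotate, norm_rotate, norm_center]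
  exact norm_exp_neg_sub_mul_norm_exp_sub_le hw hre

theorem sin_natCast_mul_eq_exp_pow (n : ℕ) (φ : ℂ) :
    sin (n * φ) = ((exp (φ * I) ^ n)⁻¹ - exp (φ * I) ^ n) * I / 2 := by
  rw [sin, ← exp_nat_mul, ← exp_neg]
  ring_nf

theorem cos_natCast_mul_eq_exp_pow (n : ℕ) (φ : ℂ) :
    cos (n * φ) = (exp (φ * I) ^ n + (exp (φ * I) ^ n)⁻¹) / 2 := by
  rw [cos, ← exp_nat_mul, ← exp_neg]
  ring_nf

end UnitCircle

section TrigInequalities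

open Real

theorem mul_sin_lt_nine_div_four {t : ℝ} (h0 : 0 ≤ t) (hπ : t ≤ π) : t * sin t < 9 / 4 := by
  rcases le_total t (11 / 5) with ht | ht
  · nlinarith [sin_le_one t]
  · have hsin : sin t ≤ π - t := by
      rw [← sin_pi_sub]
      exact sin_le (by linarith)
    nlinarith [pi_lt_d2]

theorem mul_cos_lt_five_div_eight {u : ℝ} (h0 : 0 ≤ u) (hπ : u ≤ π / 2) :
    u * cos u < 5 / 8 := by
  have hcos : cos u ≤ π / 2 - u := by
    rw [← sin_pi_div_two_sub]
    exact sin_le (by linarith)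
  nlinarith [sq_nonneg (u - π / 4), pi_lt_d2, pi_pos]

theorem sin_mul_sin_lt_one_div_four {M φ : ℝ} (hM : 9 ≤ M) (h0 : 0 ≤ φ) (hφ : M * φ ≤ π) :
    sin φ * sin (M * φ) < 1 / 4 := by
  have hsin : 0 ≤ sin (M * φ) := sin_nonneg_of_nonneg_of_le_pi (by positivity) hφ
  have hle : sin φ * sin (M * φ) ≤ φ * sin (M * φ) := by gcongr; exact sin_le h0
  have hlt : M * (φ * sin (M * φ)) < 9 / 4 := by
    rw [← mul_assoc]
    exact mul_sin_lt_nine_div_four (by positivity) hφ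
  nlinarith [mul_nonneg h0 hsin]

theorem sin_mul_sin_mul_cos_lt_one_div_eight {m φ : ℝ} (ψ : ℝ) (hm : 5 ≤ m) (h0 : 0 ≤ φ)
    (hφ : m * φ ≤ π / 2) : sin φ * sin ψ * cos (m * φ) < 1 / 8 := by
  have hmφ : 0 ≤ m * φ := by positivity
  have hcos : 0 ≤ cos (m * φ) := cos_nonneg_of_mem_Icc ⟨by linarith [pi_pos], hφ⟩
  have hsin : 0 ≤ sin φ := sin_nonneg_of_nonneg_of_le_pi h0 (by nlinarith [pi_pos])
  have hle : sin φ * sin ψ * cos (m * φ) ≤ φ * cos (m * φ) := by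
    gcongr
    exact (mul_le_of_le_one_right hsin (sin_le_one ψ)).trans (sin_le h0)
  have hlt : m * (φ * cos (m * φ)) < 5 / 8 := by
    rw [← mul_assoc]
    exact mul_cos_lt_five_div_eight hmφ hφ
  nlinarith [mul_nonneg h0 hcos]

end TrigInequalities

namespace NumericalSemigroup

section Criteria

variable {S : NumericalSemigroup}

theorem mem_gaps {n : ℕ} : n ∈ S.gaps ↔ n ∉ S.toAddSubmonoid := by
  rw [gaps, Set.Finite.mem_toFinset]
  rfl

theorem le_of_mem_gaps {F g : ℕ} (hlt : ∀ n, F < n → n ∈ S.toAddSubmonoid) (hg : g ∈ S.gaps) :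
    g ≤ F := by
  by_contra! h
  exact mem_gaps.1 hg (hlt g h)

theorem closure_eq_of_forall_exists_add {A : Set ℕ} (hA : ∀ a ∈ A, a ∈ S.toAddSubmonoid)
    (hadd : ∀ n ∈ S.toAddSubmonoid, n ≠ 0 → n ∉ A →
      ∃ a ∈ A, a ≠ 0 ∧ ∃ b ∈ S.toAddSubmonoid, n = a + b) :
    AddSubmonoid.closure A = S.toAddSubmonoid := by
  refine le_antisymm (AddSubmonoid.closure_le.2 hA) fun n => ?_
  induction n using Nat.strong_induction_on with
  | _ n ih =>
    intro hn
    by_cases hn0 : n = 0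
    · exact hn0 ▸ zero_mem _
    by_cases hnA : n ∈ A
    · exact AddSubmonoid.subset_closure hnA
    obtain ⟨a, ha, ha0, b, hb, rfl⟩ := hadd n hn hn0 hnA
    exact add_mem (AddSubmonoid.subset_closure ha) (ih b (by omega) hb)

theorem mem_or_two_mul_le_of_mem_closure {B : Set ℕ} {m x : ℕ} (hB : ∀ b ∈ B, m ≤ b)
    (hx : x ∈ AddSubmonoid.closure B) : x = 0 ∨ x ∈ B ∨ 2 * m ≤ x := by
  have hge : ∀ y, y = 0 ∨ y ∈ B ∨ 2 * m ≤ y → y = 0 ∨ m ≤ y := by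
    rintro y (hy | hy | hy)
    · exact Or.inl hy
    · exact Or.inr (hB y hy)
    · omega
  induction hx using AddSubmonoid.closure_induction with
  | mem x hx => exact Or.inr (Or.inl hx)
  | zero => exact Or.inl rfl
  | add x y _ _ hx hy =>
    rcases hge x hx with rfl | hmx
    · simpa using hy
    rcases hge y hy with rfl | hmy
    · simpa using hx
    · omega

theorem hasEmbeddingDimension_of_subset_Ico {A : Finset ℕ} {m : ℕ}
    (hA : A ⊆ Finset.Ico m (2 * m))
    (hgen : AddSubmonoid.closure (A : Set ℕ) = S.toAddSubmonoid) :
    S.HasEmbeddingDimension A.card := by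
  refine ⟨A, ⟨hgen, fun B hB hBA a ha => ?_⟩, rfl⟩
  have haB : a ∈ AddSubmonoid.closure (B : Set ℕ) :=
    (hB.trans hgen.symm) ▸ AddSubmonoid.subset_closure ha
  have hmB : ∀ b ∈ (B : Set ℕ), m ≤ b := fun b hb => (Finset.mem_Ico.1 (hA (hBA hb))).1
  have ham := Finset.mem_Ico.1 (hA ha)
  rcases mem_or_two_mul_le_of_mem_closure hmB haB with h | h | h
  · omega
  · exact h
  · omega

open Polynomial in
theorem sum_gaps_add_sum_gaps_reflect {F : ℕ} (hlt : ∀ n, F < n → n ∈ S.toAddSubmonoid)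
    (hF : ∀ n ≤ F, n ∈ S.toAddSubmonoid ↔ F - n ∉ S.toAddSubmonoid) :
    ∑ g ∈ S.gaps, (X : ℤ[X]) ^ g + ∑ g ∈ S.gaps, (X : ℤ[X]) ^ (F - g) =
      ∑ n ∈ Finset.range (F + 1), (X : ℤ[X]) ^ n := by
  have hle : ∀ g ∈ S.gaps, g ≤ F := fun _ => le_of_mem_gaps hlt
  have hgaps : S.gaps ⊆ Finset.range (F + 1) := fun g hg =>
    Finset.mem_range_succ_iff.2 (hle g hg)
  have hreflect : ∑ g ∈ S.gaps, (X : ℤ[X]) ^ (F - g) =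
      ∑ n ∈ Finset.range (F + 1) \ S.gaps, (X : ℤ[X]) ^ n := by
    refine Finset.sum_nbij' (F - ·) (F - ·) (fun g hg => ?_) (fun n hn => ?_) (fun g hg => ?_)
      (fun n hn => ?_) fun _ _ => rfl
    · have hFg : F - g ∈ S.toAddSubmonoid := by
        rw [hF _ (Nat.sub_le F g), Nat.sub_sub_self (hle g hg)]
        exact mem_gaps.1 hg
      exact Finset.mem_sdiff.2
        ⟨Finset.mem_range_succ_iff.2 (Nat.sub_le F g), fun h => mem_gaps.1 h hFg⟩
    · simp only [Finset.mem_sdiff, Finset.mem_range_succ_iff, mem_gaps, not_not] at hn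
      exact mem_gaps.2 ((hF n hn.1).1 hn.2)
    · exact Nat.sub_sub_self (hle g hg)
    · exact Nat.sub_sub_self (Finset.mem_range_succ_iff.1 (Finset.mem_sdiff.1 hn).1)
  rw [hreflect, add_comm, Finset.sum_sdiff hgaps]

open LaurentPolynomial in
theorem isSymmetric_of_forall_mem_iff {F : ℕ} (hlt : ∀ n, F < n → n ∈ S.toAddSubmonoid)
    (hF : ∀ n ≤ F, n ∈ S.toAddSubmonoid ↔ F - n ∉ S.toAddSubmonoid) : S.IsSymmetric := by
  refine ⟨F + 1, ?_⟩
  have hT : (T (F + 1 : ℕ) : ℤ[T;T⁻¹]) = T F * T 1 := by rw [← T_add]; push_cast; rfl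
  have hT1 : (T 1 * T (-1) : ℤ[T;T⁻¹]) = 1 := by rw [← T_add]; simp
  have hinvert : (T F : ℤ[T;T⁻¹]) * ∑ g ∈ S.gaps, T (-g) = ∑ g ∈ S.gaps, T (F - g : ℕ) := by
    rw [Finset.mul_sum]
    refine Finset.sum_congr rfl fun g hg => ?_
    rw [← T_add, Nat.cast_sub (le_of_mem_gaps hlt hg), sub_eq_add_neg]
  have hsum := congrArg Polynomial.toLaurent <| congrArg (· * (1 - Polynomial.X)) <|
    sum_gaps_add_sum_gaps_reflect hlt hF
  simp only [geom_sum_mul_neg, map_mul, map_add, map_sub, map_one, map_sum,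
    Polynomial.toLaurent_X_pow, Polynomial.toLaurent_X, ← hinvert, hT] at hsum
  simp only [semigroupPolynomial, map_sub, map_mul, map_one, map_sum, Polynomial.toLaurent_X,
    Polynomial.toLaurent_X_pow, invert_T, hT]
  linear_combination (-T F * ∑ g ∈ S.gaps, T (-g)) * hT1 - hsum

open Complex in
theorem not_isCyclotomic_of_midpoint_lt_one {g : ℝ → ℝ}
    (hg : ∀ φ : ℝ, ‖Polynomial.aeval (exp (2 * φ * I)) S.semigroupPolynomial‖ = |g φ|)
    {a : ℝ} (ha : 0 < a) (hpos : ∀ φ ∈ Set.Ioo 0 a, 0 < g φ) (hmid : g (a / 2) < 1)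
    (hend : g a = 1) : ¬ S.IsCyclotomic := by
  intro hS
  let P : Polynomial ℂ := S.semigroupPolynomial.map (algebraMap ℤ ℂ)
  have hP (z : ℂ) : P.eval z = Polynomial.aeval z S.semigroupPolynomial :=
    Polynomial.eval_map_algebraMap _ z
  have hroots (z : ℂ) (hz : P.IsRoot z) : ‖z‖ = 1 := hS z ((hP z).symm.trans hz)
  have norm_eval (θ : ℝ) : ‖P.eval (exp (θ * I))‖ = |g (θ / 2)| := by
    rw [hP, ← hg]
    push_cast
    rw [mul_div_cancel₀ _ two_ne_zero]
  have harc : ∀ θ ∈ Set.Ioo (a - a) (a + a), P.eval (exp (θ * I)) ≠ 0 := fun θ hθ => by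
    rw [← norm_ne_zero_iff, norm_eval, abs_ne_zero]
    exact (hpos _ ⟨by linarith [hθ.1], by linarith [hθ.2]⟩).ne'
  have hone : P.eval 1 = 1 := by simp [hP, semigroupPolynomial]
  have hle := norm_eval_exp_mul_norm_eval_exp_le_sq hroots ha.le harc
  rw [sub_self, zero_mul, exp_zero, hone, norm_one, one_mul, ← ofReal_add, norm_eval, norm_eval,
    add_self_div_two, hend, abs_one, sq_abs] at hle
  have hmid_pos := hpos (a / 2) ⟨by linarith, by linarith⟩
  nlinarith

end Criteria

section IntervalSemigroup

/-- The numerical semigroup `{0} ∪ {n ≥ e + 1 | n ≠ 2 e + 1}`, of multiplicity `e + 1` and Frobenius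
number `2 e + 1`; for `2 ≤ e` it is generated by the interval `[e + 1, 2 e]`. -/
def intervalSemigroup (e : ℕ) : NumericalSemigroup where
  carrier := {n | n = 0 ∨ e + 1 ≤ n ∧ n ≠ 2 * e + 1}
  zero_mem' := Or.inl rfl
  add_mem' := by
    intro a b ha hb
    simp only [Set.mem_ofPred_eq] at *
    omega
  finite_compl := (Set.finite_Iio (2 * e + 2)).subset fun n hn => by
    simp only [Set.mem_compl_iff, Set.mem_ofPred_eq, Set.mem_Iio] at *
    omega

variable {e : ℕ}

theorem mem_intervalSemigroup {n : ℕ} :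
    n ∈ (intervalSemigroup e).toAddSubmonoid ↔ n = 0 ∨ e + 1 ≤ n ∧ n ≠ 2 * e + 1 := Iff.rfl

theorem closure_eq_intervalSemigroup (he : 2 ≤ e) :
    AddSubmonoid.closure (Finset.Icc (e + 1) (2 * e) : Set ℕ) =
      (intervalSemigroup e).toAddSubmonoid := by
  refine closure_eq_of_forall_exists_add ?_ ?_ <;>
    simp only [mem_intervalSemigroup, SetLike.mem_coe, Finset.mem_Icc]
  · omega
  · intro n hn hn0 hnA
    by_cases h : n = 3 * e + 2
    · exact ⟨e + 2, by omega, by omega, 2 * e, by omega, by omega⟩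
    · exact ⟨e + 1, by omega, by omega, n - (e + 1), by omega, by omega⟩

theorem intervalSemigroup_hasEmbeddingDimension (he : 2 ≤ e) :
    (intervalSemigroup e).HasEmbeddingDimension e := by
  have hsub : Finset.Icc (e + 1) (2 * e) ⊆ Finset.Ico (e + 1) (2 * (e + 1)) := fun n hn => by
    rw [Finset.mem_Icc] at hn
    rw [Finset.mem_Ico]
    omega
  have hcard : (Finset.Icc (e + 1) (2 * e)).card = e := by rw [Nat.card_Icc]; omega
  simpa only [hcard] using
    hasEmbeddingDimension_of_subset_Ico hsub (closure_eq_intervalSemigroup he)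

theorem intervalSemigroup_isSymmetric (e : ℕ) : (intervalSemigroup e).IsSymmetric := by
  apply isSymmetric_of_forall_mem_iff (F := 2 * e + 1) <;>
    simp only [mem_intervalSemigroup] <;> omega

open Polynomial in
theorem intervalSemigroup_semigroupPolynomial (e : ℕ) :
    (intervalSemigroup e).semigroupPolynomial =
      1 - X + X ^ (e + 1) - X ^ (2 * e + 1) + X ^ (2 * e + 2) := by
  have hgaps : (intervalSemigroup e).gaps = insert (2 * e + 1) (Finset.Ico 1 (e + 1)) := by
    ext n
    simp only [mem_gaps, mem_intervalSemigroup, Finset.mem_insert, Finset.mem_Ico]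
    omega
  have hgeom := geom_sum_Ico_mul_neg (X : ℤ[X]) (show 1 ≤ e + 1 by omega)
  rw [semigroupPolynomial, hgaps, Finset.sum_insert (by rw [Finset.mem_Ico]; omega)]
  linear_combination -hgeom

open Complex in
theorem norm_aeval_exp_intervalSemigroup (e : ℕ) (φ : ℝ) :
    ‖Polynomial.aeval (exp (2 * φ * I)) (intervalSemigroup e).semigroupPolynomial‖ =
      |1 - 4 * Real.sin φ * Real.sin ((2 * e + 1 : ℕ) * φ)| := by
  have hsin : sin φ = ((exp (φ * I))⁻¹ - exp (φ * I)) * I / 2 := by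
    simpa using sin_natCast_mul_eq_exp_pow 1 φ
  have hsq : exp (2 * φ * I) = exp (φ * I) ^ 2 := by rw [← exp_nat_mul]; ring_nf
  have haeval : Polynomial.aeval (exp (2 * φ * I)) (intervalSemigroup e).semigroupPolynomial =
      exp (φ * I) ^ (2 * e + 2) * (1 - 4 * sin φ * sin ((2 * e + 1 : ℕ) * φ)) := by
    rw [intervalSemigroup_semigroupPolynomial, sin_natCast_mul_eq_exp_pow, hsin, hsq]
    simp only [map_add, map_sub, map_one, map_pow, Polynomial.aeval_X]
    field_simp
    rw [I_sq]
    ring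
  rw [haeval, norm_mul, norm_pow, norm_exp_ofReal_mul_I, one_pow, one_mul, ← Real.norm_eq_abs,
    ← norm_real]
  push_cast
  rfl

open Real in
theorem intervalSemigroup_not_isCyclotomic (he : 4 ≤ e) : ¬ (intervalSemigroup e).IsCyclotomic := by
  have hM : (9 : ℝ) ≤ (2 * e + 1 : ℕ) := by exact_mod_cast (by omega : 9 ≤ 2 * e + 1)
  have hM0 : (0 : ℝ) < (2 * e + 1 : ℕ) := by linarith
  have hcancel : ((2 * e + 1 : ℕ) : ℝ) * (π / (2 * e + 1 : ℕ)) = π := mul_div_cancel₀ π hM0.ne'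
  have ha : 0 < π / (2 * e + 1 : ℕ) := div_pos pi_pos hM0
  refine not_isCyclotomic_of_midpoint_lt_one (norm_aeval_exp_intervalSemigroup e) ha
    (fun φ hφ => ?_) ?_ ?_
  · have hφπ : (2 * e + 1 : ℕ) * φ ≤ π := by
      rw [mul_comm, ← le_div_iff₀ hM0]
      exact hφ.2.le
    linarith [sin_mul_sin_lt_one_div_four hM hφ.1.le hφπ]
  · have hsin : 0 < sin (π / (2 * e + 1 : ℕ) / 2) :=
      sin_pos_of_pos_of_lt_pi (by positivity) (by nlinarith)
    rw [mul_div_assoc', hcancel, sin_pi_div_two]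
    linarith
  · rw [hcancel, sin_pi]
    ring

end IntervalSemigroup

section PuncturedIntervalSemigroup

/-- The numerical semigroup `{0} ∪ {n ≥ e + 1 | n ≠ e + 2, 2 e + 3}`, of multiplicity `e + 1` and
Frobenius number `2 e + 3`; for `2 ≤ e` it is generated by `e + 1` and the interval
`[e + 3, 2 e + 1]`. -/
def puncturedIntervalSemigroup (e : ℕ) (he : 0 < e) : NumericalSemigroup where
  carrier := {n | n = 0 ∨ e + 1 ≤ n ∧ n ≠ e + 2 ∧ n ≠ 2 * e + 3}
  zero_mem' := Or.inl rfl
  add_mem' := by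
    intro a b ha hb
    simp only [Set.mem_ofPred_eq] at *
    omega
  finite_compl := (Set.finite_Iio (2 * e + 4)).subset fun n hn => by
    simp only [Set.mem_compl_iff, Set.mem_ofPred_eq, Set.mem_Iio] at *
    omega

variable {e : ℕ}

theorem mem_puncturedIntervalSemigroup {n : ℕ} {he : 0 < e} :
    n ∈ (puncturedIntervalSemigroup e he).toAddSubmonoid ↔
      n = 0 ∨ e + 1 ≤ n ∧ n ≠ e + 2 ∧ n ≠ 2 * e + 3 := Iff.rfl

theorem closure_eq_puncturedIntervalSemigroup (he : 2 ≤ e) :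
    AddSubmonoid.closure (insert (e + 1) (Finset.Icc (e + 3) (2 * e + 1)) : Finset ℕ) =
      (puncturedIntervalSemigroup e (by omega)).toAddSubmonoid := by
  refine closure_eq_of_forall_exists_add ?_ ?_ <;>
    simp only [mem_puncturedIntervalSemigroup, SetLike.mem_coe, Finset.mem_insert, Finset.mem_Icc]
  · omega
  · intro n hn hn0 hnA
    by_cases h : n = 3 * e + 4
    · exact ⟨e + 3, by omega, by omega, 2 * e + 1, by omega, by omega⟩
    · exact ⟨e + 1, by omega, by omega, n - (e + 1), by omega, by omega⟩

theorem puncturedIntervalSemigroup_hasEmbeddingDimension (he : 2 ≤ e) :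
    (puncturedIntervalSemigroup e (by omega)).HasEmbeddingDimension e := by
  have hsub : insert (e + 1) (Finset.Icc (e + 3) (2 * e + 1)) ⊆
      Finset.Ico (e + 1) (2 * (e + 1)) := fun n hn => by
    rw [Finset.mem_insert, Finset.mem_Icc] at hn
    rw [Finset.mem_Ico]
    omega
  have hcard : (insert (e + 1) (Finset.Icc (e + 3) (2 * e + 1))).card = e := by
    rw [Finset.card_insert_of_notMem (by simp), Nat.card_Icc]
    omega
  simpa only [hcard] using
    hasEmbeddingDimension_of_subset_Ico hsub (closure_eq_puncturedIntervalSemigroup he)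

theorem puncturedIntervalSemigroup_isSymmetric (he : 0 < e) :
    (puncturedIntervalSemigroup e he).IsSymmetric := by
  apply isSymmetric_of_forall_mem_iff (F := 2 * e + 3) <;>
    simp only [mem_puncturedIntervalSemigroup] <;> omega

open Polynomial in
theorem puncturedIntervalSemigroup_semigroupPolynomial (he : 0 < e) :
    (puncturedIntervalSemigroup e he).semigroupPolynomial =
      1 - X + X ^ (e + 1) - X ^ (e + 2) + X ^ (e + 3) - X ^ (2 * e + 3) + X ^ (2 * e + 4) := by
  have hgaps : (puncturedIntervalSemigroup e he).gaps =
      insert (2 * e + 3) (insert (e + 2) (Finset.Ico 1 (e + 1))) := by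
    ext n
    simp only [mem_gaps, mem_puncturedIntervalSemigroup, Finset.mem_insert, Finset.mem_Ico]
    omega
  have hgeom := geom_sum_Ico_mul_neg (X : ℤ[X]) (show 1 ≤ e + 1 by omega)
  rw [semigroupPolynomial, hgaps,
    Finset.sum_insert (by rw [Finset.mem_insert, Finset.mem_Ico]; omega),
    Finset.sum_insert (by rw [Finset.mem_Ico]; omega)]
  linear_combination -hgeom

open Complex in
theorem norm_aeval_exp_puncturedIntervalSemigroup (he : 0 < e) (φ : ℝ) :
    ‖Polynomial.aeval (exp (2 * φ * I)) (puncturedIntervalSemigroup e he).semigroupPolynomial‖ =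
      |1 - 8 * (Real.sin φ * Real.sin ((e + 2 : ℕ) * φ) * Real.cos ((e + 1 : ℕ) * φ))| := by
  have hsin : sin φ = ((exp (φ * I))⁻¹ - exp (φ * I)) * I / 2 := by
    simpa using sin_natCast_mul_eq_exp_pow 1 φ
  have hsq : exp (2 * φ * I) = exp (φ * I) ^ 2 := by rw [← exp_nat_mul]; ring_nf
  have haeval : Polynomial.aeval (exp (2 * φ * I))
        (puncturedIntervalSemigroup e he).semigroupPolynomial =
      exp (φ * I) ^ (2 * e + 4) *
        (1 - 8 * (sin φ * sin ((e + 2 : ℕ) * φ) * cos ((e + 1 : ℕ) * φ))) := by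
    rw [puncturedIntervalSemigroup_semigroupPolynomial, sin_natCast_mul_eq_exp_pow,
      cos_natCast_mul_eq_exp_pow, hsin, hsq]
    simp only [map_add, map_sub, map_one, map_pow, Polynomial.aeval_X]
    field_simp
    rw [I_sq]
    ring
  rw [haeval, norm_mul, norm_pow, norm_exp_ofReal_mul_I, one_pow, one_mul, ← Real.norm_eq_abs,
    ← norm_real]
  push_cast
  rfl

open Real in
theorem puncturedIntervalSemigroup_not_isCyclotomic (he : 4 ≤ e) :
    ¬ (puncturedIntervalSemigroup e (by omega)).IsCyclotomic := by
  have hm : (5 : ℝ) ≤ (e + 1 : ℕ) := by exact_mod_cast (by omega : 5 ≤ e + 1)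
  have hm0 : (0 : ℝ) < (e + 1 : ℕ) := by linarith
  set a : ℝ := π / 2 / (e + 1 : ℕ)
  have hma : (e + 1 : ℕ) * a = π / 2 := mul_div_cancel₀ _ hm0.ne'
  have ha : 0 < a := div_pos pi_div_two_pos hm0
  have ha5 : 5 * a ≤ π / 2 := hma ▸ mul_le_mul_of_nonneg_right hm ha.le
  refine not_isCyclotomic_of_midpoint_lt_one (norm_aeval_exp_puncturedIntervalSemigroup _) ha
    (fun φ hφ => ?_) ?_ ?_
  · have hφπ : (e + 1 : ℕ) * φ ≤ π / 2 :=
      hma ▸ mul_le_mul_of_nonneg_left hφ.2.le hm0.le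
    linarith [sin_mul_sin_mul_cos_lt_one_div_eight ((e + 2 : ℕ) * φ) hm hφ.1.le hφπ]
  · have hsin : 0 < sin (a / 2) := sin_pos_of_pos_of_lt_pi (by linarith) (by linarith)
    have hmid : (e + 1 : ℕ) * (a / 2) = π / 4 := by rw [mul_div_assoc', hma]; ring
    have hmid' : (e + 2 : ℕ) * (a / 2) = π / 4 + a / 2 := by rw [← hmid]; push_cast; ring
    have hsin' : 0 < sin (π / 4 + a / 2) :=
      sin_pos_of_pos_of_lt_pi (by linarith) (by linarith)
    have hcos : 0 < cos (π / 4) := cos_pos_of_mem_Ioo ⟨by linarith, by linarith⟩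
    rw [hmid, hmid']
    linarith [mul_pos (mul_pos hsin hsin') hcos]
  · rw [hma, cos_pi_div_two]
    ring

end PuncturedIntervalSemigroup

theorem intervalSemigroup_ne_puncturedIntervalSemigroup {e : ℕ} (he : 2 ≤ e) :
    intervalSemigroup e ≠ puncturedIntervalSemigroup e (by omega) := fun h => by
  have hmem : e + 2 ∈ (intervalSemigroup e).toAddSubmonoid :=
    mem_intervalSemigroup.2 (by omega)
  rw [h, mem_puncturedIntervalSemigroup] at hmem
  omega

end NumericalSemigroup

theorem theorem2 (e : ℕ) (he : 4 ≤ e) :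
    (∃ S T : NumericalSemigroup, S ≠ T ∧
      (S.HasEmbeddingDimension e ∧ S.IsSymmetric ∧ ¬ S.IsCyclotomic) ∧
      (T.HasEmbeddingDimension e ∧ T.IsSymmetric ∧ ¬ T.IsCyclotomic)) ∧
    NumericalSemigroup.CY e ≠ NumericalSemigroup.SY e := by
  have hdim := NumericalSemigroup.intervalSemigroup_hasEmbeddingDimension (e := e) (by omega)
  have hsym := NumericalSemigroup.intervalSemigroup_isSymmetric e
  have hcyc := NumericalSemigroup.intervalSemigroup_not_isCyclotomic he
  refine ⟨⟨_, _, NumericalSemigroup.intervalSemigroup_ne_puncturedIntervalSemigroup (by omega),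
    ⟨hdim, hsym, hcyc⟩,
    NumericalSemigroup.puncturedIntervalSemigroup_hasEmbeddingDimension (by omega),
    NumericalSemigroup.puncturedIntervalSemigroup_isSymmetric _,
    NumericalSemigroup.puncturedIntervalSemigroup_not_isCyclotomic he⟩, fun hCYSY => ?_⟩
  have hCY : NumericalSemigroup.intervalSemigroup e ∈ NumericalSemigroup.CY e :=
    hCYSY ▸ ⟨hdim, hsym⟩
  exact hcyc hCY.2
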